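/- Conventions. A semitopological semigroup is a semigroup with a topology in which multiplication is separately continuous. Such a $G$ is right amenable if there is a continuous linear functional $m$ on the space $C_b(G)$ of bounded continuous complex-valued functions with $m(\mathbf 1)=\|m\|=1$ and $m(R_gf)=m(f)$ for all $g\in G$, $f\in C_b(G)$, where $R_gf(h)=f(hg)$. $G$ acts on a compact Hausdorff space $K$ if a (jointly) continuous map $G\times K\to K$, $(g,x)\mapsto gx$, is given with $(g_1g_2)x=g_1(g_2x)$. For a topological group $\Omega$, a continuous cocycle is a continuous map $\gamma:G\times K\to\Omega$ with $\gamma(g_1g_2,x)=\gamma(g_2,x)\,\gamma(g_1,g_2x)$ for all $g_1,g_2\in G$, $x\in K$. A semigroup $\mathcal S$ of bounded linear operators on a Banach space is mean ergodic if the closure $\overline{\operatorname{co}}\,\mathcal S$ of its convex hull in the strong operator topology contains a zero element, i.e. some $P$ with $AP=PA=P$ for all $A\in\overline{\operatorname{co}}\,\mathcal S$. Theorem. Let $G$ be a right amenable semitopological semigroup acting on a compact Hausdorff space $K$, let $\Omega$ be a compact Hausdorff topological group and let $\gamma:G\times K\to\Omega$ be a continuous cocycle. Let $G$ act on $K\times\Omega$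 by the skew product action $g(x,\omega)=(gx,\omega\gamma(g,x))$, and let $\mathcal T=\{T_g:g\in G\}$, $T_gF(x,\omega)=F(gx,\omega\gamma(g,x))$, be its Koopman representation on $C(K\times\Omega)$. For a continuous unitary representation $\pi:\Omega\to U(N)$ on $\mathbb C^N$ let $(\pi\circ\gamma)\mathcal S^{(N)}$ be the semigroup of the operators $f\mapsto\bigl(x\mapsto\pi(\gamma(g,x))f(gx)\bigr)$, $g\in G$, on $C(K,\mathbb C^N)$, the latter with the norm $\|f\|=\sup_{x\in K}\|f(x)\|_2$. Then the following assertions are equivalent. (1) $\mathcal T$ is mean ergodic on $C(K\times\Omega)$. (2) $(\pi\circ\gamma)\mathcal S^{(N)}$ is mean ergodic on $C(K,\mathbb C^N)$ for each $N\in\mathbb N$ and each irreducible continuous unitary representation $\pi:\Omega\to U(N)$. -/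

import Mathlib

open scoped BoundedContinuousFunction

noncomputable section

namespace GroupExtension

/-! ### Right amenable semitopological semigroups -/

/-- Right translation `(R_g f)(h) = f (h g)` on the space `C_b(G)` of bounded continuous
complex-valued functions. -/
def rightTranslate {G : Type*} [Semigroup G] [TopologicalSpace G] [SeparatelyContinuousMul G]
    (g : G) (f : G →ᵇ ℂ) : G →ᵇ ℂ :=
  f.compContinuous ⟨fun h => h * g, continuous_mul_const g⟩

/-- A mean on `C_b(G)`: a continuous linear functional `m` with `⟨m, 1⟩ = ‖m‖ = 1`. -/
def IsMean {G : Type*} [TopologicalSpace G] (m : (G →ᵇ ℂ) →L[ℂ] ℂ) : Prop :=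
  m (BoundedContinuousFunction.const G 1) = 1 ∧ ‖m‖ = 1

/-- A semitopological semigroup `G` is right amenable if there is a right invariant mean
on `C_b(G)`. -/
def RightAmenable (G : Type*) [Semigroup G] [TopologicalSpace G]
    [SeparatelyContinuousMul G] : Prop :=
  ∃ m : (G →ᵇ ℂ) →L[ℂ] ℂ, IsMean m ∧ ∀ (g : G) (f : G →ᵇ ℂ), m (rightTranslate g f) = m f

/-! ### Mean ergodic operator semigroups -/

/-- The closure of the convex hull of a set `S` of bounded operators on `X`, with respect to the
strong operator topology (the topology of pointwise convergence). -/
def strongClosedConvexHull {X : Type*} [NormedAddCommGroup X] [NormedSpace ℂ X]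
    (S : Set (X →L[ℂ] X)) : Set (X →L[ℂ] X) :=
  ContinuousLinearMap.toPointwiseConvergenceCLM ℂ (RingHom.id ℂ) X X ⁻¹'
    closure (ContinuousLinearMap.toPointwiseConvergenceCLM ℂ (RingHom.id ℂ) X X ''
      convexHull ℝ S)

/-- A semigroup `S` of bounded operators is mean ergodic if the strong operator closure of its
convex hull contains a zero element `P` (that is, `A P = P A = P` for all `A` in that closure). -/
def IsMeanErgodic {X : Type*} [NormedAddCommGroup X] [NormedSpace ℂ X]
    (S : Set (X →L[ℂ] X)) : Prop :=
  ∃ P ∈ strongClosedConvexHull S, ∀ A ∈ strongClosedConvexHull S, A * P = P ∧ P * A = P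

/-! ### Koopman operators -/

/-- The Koopman operator `(S_g f)(x) = f (g x)` on the space `C(K, E)` with the sup norm. -/
def koopman {G : Type*} (K E : Type*) [TopologicalSpace K] [CompactSpace K]
    [SMul G K] [ContinuousConstSMul G K] [NormedAddCommGroup E] [NormedSpace ℂ E] (g : G) :
    C(K, E) →L[ℂ] C(K, E) :=
  LinearMap.mkContinuous
    { toFun := fun f => f.comp ⟨fun x => g • x, continuous_const_smul g⟩
      map_add' := fun _ _ => rfl
      map_smul' := fun _ _ => rfl } 1
    (fun f => by
      rw [one_mul]
      exact (ContinuousMap.norm_le _ (norm_nonneg f)).2 fun x => f.norm_coe_le_norm (g • x))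

/-! ### Continuous cocycles and skew products -/

/-- A continuous cocycle `γ : G × K → Ω`:
`γ(g₁ g₂, x) = γ(g₂, x) γ(g₁, g₂ x)`. -/
structure ContinuousCocycle (G K Ω : Type*) [Semigroup G] [TopologicalSpace G]
    [TopologicalSpace K] [SemigroupAction G K] [Mul Ω] [TopologicalSpace Ω] where
  /-- The underlying function. -/
  toFun : G → K → Ω
  continuous_toFun : Continuous fun p : G × K => toFun p.1 p.2
  cocycle : ∀ (g₁ g₂ : G) (x : K), toFun (g₁ * g₂) x = toFun g₂ x * toFun g₁ (g₂ • x)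

/-- The cocycle `π ∘ γ`, for a continuous homomorphism `π`. -/
def ContinuousCocycle.map {G K Ω Ω' : Type*} [Semigroup G] [TopologicalSpace G]
    [TopologicalSpace K] [SemigroupAction G K] [Monoid Ω] [TopologicalSpace Ω]
    [Monoid Ω'] [TopologicalSpace Ω'] (π : Ω →ₜ* Ω') (γ : ContinuousCocycle G K Ω) :
    ContinuousCocycle G K Ω' where
  toFun g x := π (γ.toFun g x)
  continuous_toFun := π.continuous_toFun.comp γ.continuous_toFun
  cocycle g₁ g₂ x := by rw [γ.cocycle, map_mul]

/-- The product space `K × Ω`, on which `G` acts by the skew product action given by `γ`. -/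
def SkewProduct {G K Ω : Type*} [Semigroup G] [TopologicalSpace G] [TopologicalSpace K]
    [SemigroupAction G K] [Mul Ω] [TopologicalSpace Ω] (_γ : ContinuousCocycle G K Ω) : Type _ :=
  K × Ω

namespace SkewProduct

variable {G K Ω : Type*} [Semigroup G] [TopologicalSpace G] [TopologicalSpace K]
  [SemigroupAction G K] [Group Ω] [TopologicalSpace Ω] (γ : ContinuousCocycle G K Ω)

instance : TopologicalSpace (SkewProduct γ) := inferInstanceAs (TopologicalSpace (K × Ω))

instance [CompactSpace K] [CompactSpace Ω] : CompactSpace (SkewProduct γ) :=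
  inferInstanceAs (CompactSpace (K × Ω))

/-- The skew product action `g (x, ω) = (g x, ω γ(g, x))`. -/
instance : SemigroupAction G (SkewProduct γ) where
  smul g p := (g • p.1, p.2 * γ.toFun g p.1)
  mul_smul g₁ g₂ p :=
    Prod.ext (SemigroupAction.mul_smul g₁ g₂ p.1)
      (by
        change p.2 * γ.toFun (g₁ * g₂) p.1 = p.2 * γ.toFun g₂ p.1 * γ.toFun g₁ (g₂ • p.1)
        rw [γ.cocycle, mul_assoc])

instance [ContinuousSMul G K] [IsTopologicalGroup Ω] : ContinuousSMul G (SkewProduct γ) where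
  continuous_smul := by
    have h₁ : Continuous fun q : G × (K × Ω) => q.1 • q.2.1 :=
      continuous_fst.smul (continuous_fst.comp continuous_snd)
    have h₂ : Continuous fun q : G × (K × Ω) => q.2.2 * γ.toFun q.1 q.2.1 :=
      (continuous_snd.comp continuous_snd).mul
        (γ.continuous_toFun.comp
          (continuous_fst.prodMk (continuous_fst.comp continuous_snd)))
    exact h₁.prodMk h₂

end SkewProduct

/-! ### Unitary representations and the twisted Koopman semigroups -/

/-- `ℂ^N` with the Euclidean norm. -/
abbrev CN (N : ℕ) : Type := EuclideanSpace ℂ (Fin N)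

/-- The topological group `U(N)` of unitary operators on `ℂ^N`. -/
abbrev UN (N : ℕ) : Type := unitary (CN N →L[ℂ] CN N)

/-- The linear representation of `Ω` on `ℂ^N` underlying a unitary representation. -/
def toRepresentation {Ω : Type*} [Monoid Ω] [TopologicalSpace Ω] {N : ℕ} (π : Ω →ₜ* UN N) :
    Representation ℂ Ω (CN N) where
  toFun ω := ((π ω : CN N →L[ℂ] CN N) : CN N →ₗ[ℂ] CN N)
  map_one' := by rw [show π 1 = 1 from π.map_one']; rfl
  map_mul' ω₁ ω₂ := by rw [show π (ω₁ * ω₂) = π ω₁ * π ω₂ from π.map_mul' ω₁ ω₂]; rfl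

/-- The operator `γ(g, ·) S_g` on `C(K, ℂ^N)`, that is, `f ↦ (x ↦ γ(g, x) (f (g x)))`,
for a continuous cocycle `γ` with values in `U(N)`. -/
def twistedKoopman {G K : Type*} [Semigroup G] [TopologicalSpace G] [TopologicalSpace K]
    [CompactSpace K] [SemigroupAction G K] [ContinuousConstSMul G K] {N : ℕ}
    (γ : ContinuousCocycle G K (UN N)) (g : G) : C(K, CN N) →L[ℂ] C(K, CN N) :=
  LinearMap.mkContinuous
    { toFun := fun f => ⟨fun x => (γ.toFun g x : CN N →L[ℂ] CN N) (koopman K (CN N) g f x),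
        ((continuous_subtype_val.comp γ.continuous_toFun).comp
          (continuous_const.prodMk continuous_id)).clm_apply (koopman K (CN N) g f).continuous⟩
      map_add' := fun f₁ f₂ => by ext1 x; simp
      map_smul' := fun c f => by ext1 x; simp } 1
    (fun f => by
      rw [one_mul]
      refine (ContinuousMap.norm_le _ (norm_nonneg f)).2 fun x => ?_
      refine le_trans (le_of_eq ?_) (f.norm_coe_le_norm (g • x))
      exact Unitary.norm_map (γ.toFun g x) (f (g • x)))

end GroupExtension

end

/-!
The proof rests on a description of mean ergodicity for a semigroup `S` of contractions in terms of
single vectors. Call `y` the ergodic limit of `x` if `y` is fixed by `S` and, for every `A` in the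
convex hull of `S`, the vector `y` lies in the closed convex hull of the orbit of `A x`
(`IsErgodicLimit`). Convex combinations that work for one vector can be composed with those that
work for another, since a contraction fixing `y'` does not spoil an approximation of `y'`; hence one
convex combination serves finitely many vectors at once. It follows that ergodic limits are unique
and linear in the vector, that the vectors possessing one form a closed subspace, and that `S` is
mean ergodic if and only if every vector possesses one
(`isMeanErgodic_iff_forall_exists_isErgodicLimit`).

For a unitary representation `π` of `Ω` on `ℂ^N` and `v ∈ ℂ^N`, the operator
`f ↦ ((x, ω) ↦ ⟨v, π(ω) f(x)⟩)` from `C(K, ℂ^N)` to `C(K × Ω)` intertwines the twisted Koopman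
operators with those of the skew product (`coefficientMap_twistedKoopman`). Letting `v` run through
an orthonormal basis embeds `C(K, ℂ^N)` into a power of `C(K × Ω)`, with left inverse obtained from
`F ↦ F(·, 1)`, so ergodic limits descend to `C(K, ℂ^N)`
(`exists_isErgodicLimit_of_intertwines`). Conversely, if all twisted semigroups are mean ergodic,
every function in the range of one of these operators has an ergodic limit, and those functions span
a dense subspace of `C(K × Ω)` (`eq_top_of_forall_coefficientMap_mem`) by the Stone–Weierstrass
theorem and the Peter–Weyl theorem.

The Peter–Weyl theorem (`peterWeyl`) is obtained in the following form: a closed subspace `V` of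
`C(Ω)` containing the matrix coefficients of all irreducible finite-dimensional unitary
representations is everything. Complete reducibility puts the coefficients of vectors in
finite-dimensional invariant subspaces into `V`. In any unitary representation of a compact group
such subspaces span a dense subspace, by the spectral theorem applied to the average over the group
of a rank-one operator. So `V` contains all coefficients of the regular representation on `L²(Ω)`,
and coefficients taken against normalized indicator functions of small neighbourhoods of `1`
approximate every continuous function uniformly.
-/

noncomputable section

namespace GroupExtension

/-! ### Mean ergodic semigroups of contractions -/

section MeanErgodic

variable {X : Type*} [NormedAddCommGroup X] [NormedSpace ℂ X]

lemma mem_strongClosedConvexHull_iff {S : Set (X →L[ℂ] X)} {P : X →L[ℂ] X} :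
    P ∈ strongClosedConvexHull S ↔
      ∀ (s : Finset X) (ε : ℝ), 0 < ε → ∃ B ∈ convexHull ℝ S, ∀ x ∈ s, ‖B x - P x‖ < ε := by
  have hemb := (PointwiseConvergenceCLM.isEmbedding_coeFn (RingHom.id ℂ) X X).isInducing
  unfold strongClosedConvexHull
  rw [Set.mem_preimage, hemb.closure_eq_preimage_closure_image, Set.mem_preimage, mem_closure_iff]
  constructor
  · intro h s ε hε
    have hopen : IsOpen (Set.pi (s : Set X) fun x => Metric.ball (P x) ε) :=
      isOpen_set_pi s.finite_toSet fun x _ => Metric.isOpen_ball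
    obtain ⟨_, h1, _, ⟨B, hB, rfl⟩, rfl⟩ := h _ hopen (fun x _ => Metric.mem_ball_self hε)
    refine ⟨B, hB, fun x hx => ?_⟩
    have := h1 x hx
    rwa [Metric.mem_ball, dist_eq_norm] at this
  · intro h o ho hPo
    obtain ⟨I, u, hu, hsub⟩ := isOpen_pi_iff.1 ho _ hPo
    have hε : ∀ x : X, ∃ ε : ℝ, 0 < ε ∧ (x ∈ I → Metric.ball (P x) ε ⊆ u x) := by
      intro x
      by_cases hx : x ∈ I
      · obtain ⟨ε, h0, h1⟩ := Metric.isOpen_iff.1 (hu x hx).1 _ (hu x hx).2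
        exact ⟨ε, h0, fun _ => h1⟩
      · exact ⟨1, one_pos, fun h => absurd h hx⟩
    choose ε hε0 hε1 using hε
    have hδ : ∃ δ : ℝ, 0 < δ ∧ ∀ x ∈ I, δ ≤ ε x := by
      rcases I.eq_empty_or_nonempty with rfl | hI
      · exact ⟨1, one_pos, by simp⟩
      · exact ⟨I.inf' hI ε, (Finset.lt_inf'_iff hI).2 fun x _ => hε0 x,
          fun x hx => Finset.inf'_le _ hx⟩
    obtain ⟨δ, hδ0, hδ⟩ := hδ
    obtain ⟨B, hB, hBP⟩ := h I δ hδ0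
    refine ⟨B, hsub fun x hx => hε1 x hx ?_, _, ⟨B, hB, rfl⟩, rfl⟩
    rw [Metric.mem_ball, dist_eq_norm]
    exact (hBP x hx).trans_le (hδ x hx)

lemma mul_mem_convexHull {S : Set (X →L[ℂ] X)} (hS : ∀ A ∈ S, ∀ B ∈ S, A * B ∈ S)
    {A B : X →L[ℂ] X} (hA : A ∈ convexHull ℝ S) (hB : B ∈ convexHull ℝ S) :
    A * B ∈ convexHull ℝ S := by
  have h1 : ∀ A ∈ S, ∀ B ∈ convexHull ℝ S, A * B ∈ convexHull ℝ S := fun A hA =>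
    convexHull_min (t := {B | A * B ∈ convexHull ℝ S})
      (fun B hB => subset_convexHull ℝ S (hS A hA B hB))
      ((convex_convexHull ℝ S).linear_preimage (LinearMap.mulLeft ℝ A))
  exact convexHull_min (t := {A | A * B ∈ convexHull ℝ S}) (fun A hA => h1 A hA B hB)
    ((convex_convexHull ℝ S).linear_preimage (LinearMap.mulRight ℝ B)) hA

lemma norm_apply_le_of_mem_convexHull {S : Set (X →L[ℂ] X)} (hS : ∀ A ∈ S, ‖A‖ ≤ 1)
    {A : X →L[ℂ] X} (hA : A ∈ convexHull ℝ S) (x : X) : ‖A x‖ ≤ ‖x‖ := by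
  have h : A ∈ Metric.closedBall (0 : X →L[ℂ] X) 1 :=
    convexHull_min (fun B hB => by simpa using hS B hB) (convex_closedBall _ _) hA
  have h1 : ‖A‖ ≤ 1 := by simpa using h
  simpa only [one_mul] using A.le_of_opNorm_le h1 x

lemma apply_eq_of_mem_convexHull {S : Set (X →L[ℂ] X)} {y : X} (hy : ∀ A ∈ S, A y = y)
    {A : X →L[ℂ] X} (hA : A ∈ convexHull ℝ S) : A y = y :=
  convexHull_min (t := {A : X →L[ℂ] X | A y = y}) hy (by
    intro A hA B hB a b _ _ hab
    change a • A y + b • B y = y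
    rw [hA, hB, ← add_smul, hab, one_smul]) hA

/-- `y` is the ergodic limit of `x` under `S`: it is fixed by `S` and it lies in the closed convex
hull of the orbit of `A x` for every convex combination `A` of elements of `S`. -/
def IsErgodicLimit (S : Set (X →L[ℂ] X)) (x y : X) : Prop :=
  (∀ A ∈ S, A y = y) ∧
    ∀ A ∈ convexHull ℝ S, ∀ ε : ℝ, 0 < ε → ∃ B ∈ convexHull ℝ S, ‖B (A x) - y‖ < ε

/-- The key approximation property: ergodic limits of finitely many vectors are approximated by
one and the same convex combination. -/
lemma IsErgodicLimit.exists_forall_mem_finset {S : Set (X →L[ℂ] X)}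
    (hmul : ∀ A ∈ S, ∀ B ∈ S, A * B ∈ S) (hS : ∀ A ∈ S, ‖A‖ ≤ 1)
    {A : X →L[ℂ] X} (hA : A ∈ convexHull ℝ S) {ε : ℝ} (hε : 0 < ε) {ι : Type*} {x y : ι → X}
    (s : Finset ι) (h : ∀ i ∈ s, IsErgodicLimit S (x i) (y i)) :
    ∃ B ∈ convexHull ℝ S, ∀ i ∈ s, ‖B (A (x i)) - y i‖ < ε := by
  classical
  induction s using Finset.induction_on with
  | empty => exact ⟨A, hA, by simp⟩
  | insert j s hj ih =>
    obtain ⟨B, hB, hBs⟩ := ih fun i hi => h i (Finset.mem_insert_of_mem hi)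
    obtain ⟨C, hC, hCj⟩ :=
      (h j (Finset.mem_insert_self j s)).2 (B * A) (mul_mem_convexHull hmul hB hA) ε hε
    refine ⟨C * B, mul_mem_convexHull hmul hC hB, fun i hi => ?_⟩
    rcases Finset.mem_insert.1 hi with rfl | hi
    · exact hCj
    · -- the contraction `C` fixes `y i`, hence does not spoil the approximation found before
      have h1 : (C * B) (A (x i)) - y i = C (B (A (x i)) - y i) := by
        rw [map_sub, apply_eq_of_mem_convexHull (h i (Finset.mem_insert_of_mem hi)).1 hC]
        rfl
      rw [h1]
      exact (norm_apply_le_of_mem_convexHull hS hC _).trans_lt (hBs i hi)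

lemma IsErgodicLimit.add {S : Set (X →L[ℂ] X)}
    (hmul : ∀ A ∈ S, ∀ B ∈ S, A * B ∈ S) (hS : ∀ A ∈ S, ‖A‖ ≤ 1) {x y x' y' : X}
    (h : IsErgodicLimit S x y) (h' : IsErgodicLimit S x' y') :
    IsErgodicLimit S (x + x') (y + y') := by
  refine ⟨fun A hA => by rw [map_add, h.1 A hA, h'.1 A hA], fun A hA ε hε => ?_⟩
  obtain ⟨B, hB, hBx⟩ := IsErgodicLimit.exists_forall_mem_finset hmul hS hA (half_pos hε)
    (x := fun p : X × X => p.1) (y := fun p => p.2) (by classical exact {(x, y), (x', y')})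
    (by simp [h, h'])
  refine ⟨B, hB, ?_⟩
  have h1 := hBx (x, y) (by simp)
  have h2 := hBx (x', y') (by simp)
  have h3 : B (A (x + x')) - (y + y') = (B (A x) - y) + (B (A x') - y') := by
    simp only [map_add]; abel
  rw [h3]
  calc _ ≤ ‖B (A x) - y‖ + ‖B (A x') - y'‖ := norm_add_le _ _
    _ < ε / 2 + ε / 2 := add_lt_add h1 h2
    _ = ε := add_halves ε

lemma IsErgodicLimit.zero {S : Set (X →L[ℂ] X)} : IsErgodicLimit S (0 : X) 0 :=
  ⟨fun A _ => map_zero A, fun A hA ε hε => ⟨A, hA, by simpa using hε⟩⟩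

lemma IsErgodicLimit.smul {S : Set (X →L[ℂ] X)} {x y : X} (h : IsErgodicLimit S x y) (c : ℂ) :
    IsErgodicLimit S (c • x) (c • y) := by
  refine ⟨fun A hA => by rw [map_smul, h.1 A hA], fun A hA ε hε => ?_⟩
  obtain ⟨B, hB, hBx⟩ := h.2 A hA (ε / (‖c‖ + 1)) (by positivity)
  refine ⟨B, hB, ?_⟩
  rw [map_smul, map_smul, ← smul_sub, norm_smul]
  rw [lt_div_iff₀ (by positivity)] at hBx
  nlinarith [norm_nonneg (B (A x) - y)]

lemma IsErgodicLimit.norm_le {S : Set (X →L[ℂ] X)} (hne : S.Nonempty)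
    (hS : ∀ A ∈ S, ‖A‖ ≤ 1) {x y : X} (h : IsErgodicLimit S x y) : ‖y‖ ≤ ‖x‖ := by
  obtain ⟨A, hA⟩ := hne
  have hA := subset_convexHull ℝ S hA
  refine le_of_forall_pos_le_add fun ε hε => ?_
  obtain ⟨B, hB, hBx⟩ := h.2 A hA ε hε
  have h1 := norm_apply_le_of_mem_convexHull hS hB (A x)
  have h2 := norm_apply_le_of_mem_convexHull hS hA x
  have h3 : ‖y‖ ≤ ‖B (A x)‖ + ‖B (A x) - y‖ := by
    rw [← norm_neg (B (A x) - y), neg_sub]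
    calc ‖y‖ = ‖B (A x) + (y - B (A x))‖ := by rw [add_sub_cancel]
      _ ≤ _ := norm_add_le _ _
  linarith

lemma IsErgodicLimit.norm_sub_le {S : Set (X →L[ℂ] X)} (hne : S.Nonempty)
    (hmul : ∀ A ∈ S, ∀ B ∈ S, A * B ∈ S) (hS : ∀ A ∈ S, ‖A‖ ≤ 1) {x y x' y' : X}
    (h : IsErgodicLimit S x y) (h' : IsErgodicLimit S x' y') : ‖y - y'‖ ≤ ‖x - x'‖ := by
  have := (h.add hmul hS (h'.smul (-1))).norm_le hne hS
  simpa [sub_eq_add_neg] using this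

lemma IsErgodicLimit.eq {S : Set (X →L[ℂ] X)} (hne : S.Nonempty)
    (hmul : ∀ A ∈ S, ∀ B ∈ S, A * B ∈ S) (hS : ∀ A ∈ S, ‖A‖ ≤ 1) {x y y' : X}
    (h : IsErgodicLimit S x y) (h' : IsErgodicLimit S x y') : y = y' := by
  have := h.norm_sub_le hne hmul hS h'
  rw [sub_self, norm_zero] at this
  exact sub_eq_zero.1 (norm_le_zero_iff.1 this)

lemma IsErgodicLimit.apply_left {S : Set (X →L[ℂ] X)} (hmul : ∀ A ∈ S, ∀ B ∈ S, A * B ∈ S)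
    {x y : X} (h : IsErgodicLimit S x y) {A : X →L[ℂ] X} (hA : A ∈ convexHull ℝ S) :
    IsErgodicLimit S (A x) y :=
  ⟨h.1, fun B hB ε hε => h.2 (B * A) (mul_mem_convexHull hmul hB hA) ε hε⟩

/-- For a semigroup `S` of contractions, the vectors that have an ergodic limit form a subspace. -/
def ergodicSubspace (S : Set (X →L[ℂ] X)) (hmul : ∀ A ∈ S, ∀ B ∈ S, A * B ∈ S)
    (hS : ∀ A ∈ S, ‖A‖ ≤ 1) : Submodule ℂ X where
  carrier := {x | ∃ y, IsErgodicLimit S x y}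
  add_mem' := fun ⟨y, h⟩ ⟨y', h'⟩ => ⟨y + y', h.add hmul hS h'⟩
  zero_mem' := ⟨0, .zero⟩
  smul_mem' := fun c _ ⟨y, h⟩ => ⟨c • y, h.smul c⟩

lemma isClosed_ergodicSubspace [CompleteSpace X] {S : Set (X →L[ℂ] X)} (hne : S.Nonempty)
    (hmul : ∀ A ∈ S, ∀ B ∈ S, A * B ∈ S) (hS : ∀ A ∈ S, ‖A‖ ≤ 1) :
    IsClosed (ergodicSubspace S hmul hS : Set X) := by
  refine IsSeqClosed.isClosed fun u x hu hux => ?_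
  choose y hy using hu
  have hcau : CauchySeq y := by
    rw [Metric.cauchySeq_iff']
    intro ε hε
    obtain ⟨N, hN⟩ := Metric.cauchySeq_iff'.1 hux.cauchySeq ε hε
    refine ⟨N, fun n hn => ?_⟩
    have := hN n hn
    rw [dist_eq_norm] at this ⊢
    exact ((hy n).norm_sub_le hne hmul hS (hy N)).trans_lt this
  obtain ⟨z, hz⟩ := cauchySeq_tendsto_of_complete hcau
  refine ⟨z, fun A hA => ?_, fun A hA ε hε => ?_⟩
  · refine tendsto_nhds_unique ((A.continuous.tendsto z).comp hz) (hz.congr fun n => ?_)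
    exact ((hy n).1 A hA).symm
  · obtain ⟨n, hn1, hn2⟩ := ((Metric.tendsto_nhds.1 hux (ε / 3) (by positivity)).and
      (Metric.tendsto_nhds.1 hz (ε / 3) (by positivity))).exists
    rw [dist_eq_norm] at hn1 hn2
    obtain ⟨B, hB, hBn⟩ := (hy n).2 A hA (ε / 3) (by positivity)
    refine ⟨B, hB, ?_⟩
    have h1 : ‖B (A (u n - x))‖ < ε / 3 :=
      ((norm_apply_le_of_mem_convexHull hS hB _).trans
        (norm_apply_le_of_mem_convexHull hS hA _)).trans_lt hn1
    have h2 : B (A x) - z = (B (A (u n)) - y n) - B (A (u n - x)) + (y n - z) := by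
      simp only [map_sub]; abel
    rw [h2]
    have h3 := norm_add_le ((B (A (u n)) - y n) - B (A (u n - x))) (y n - z)
    have h4 := norm_sub_le (B (A (u n)) - y n) (B (A (u n - x)))
    linarith

/-- A semigroup of contractions is mean ergodic if and only if every vector has an ergodic
limit. -/
theorem isMeanErgodic_iff_forall_exists_isErgodicLimit {S : Set (X →L[ℂ] X)}
    (hne : S.Nonempty) (hmul : ∀ A ∈ S, ∀ B ∈ S, A * B ∈ S) (hS : ∀ A ∈ S, ‖A‖ ≤ 1) :
    IsMeanErgodic S ↔ ∀ x, ∃ y, IsErgodicLimit S x y := by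
  have hsub : convexHull ℝ S ⊆ strongClosedConvexHull S := fun A hA =>
    mem_strongClosedConvexHull_iff.2 fun s ε hε => ⟨A, hA, by simpa using fun _ _ => hε⟩
  constructor
  · rintro ⟨P, hP, hPA⟩ x
    refine ⟨P x, fun A hA => ?_, fun A hA ε hε => ?_⟩
    · exact DFunLike.congr_fun (hPA A (hsub (subset_convexHull ℝ S hA))).1 x
    · obtain ⟨B, hB, hBP⟩ := mem_strongClosedConvexHull_iff.1 hP {A x} ε hε
      refine ⟨B, hB, ?_⟩
      have h1 : P (A x) = P x := DFunLike.congr_fun (hPA A (hsub hA)).2 x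
      simpa [h1] using hBP
  · intro h
    choose p hp using h
    let P : X →L[ℂ] X := LinearMap.mkContinuous
      { toFun := p
        map_add' := fun x x' => (hp _).eq hne hmul hS ((hp x).add hmul hS (hp x'))
        map_smul' := fun c x => (hp _).eq hne hmul hS ((hp x).smul c) } 1
      fun x => by simpa using (hp x).norm_le hne hS
    obtain ⟨A₀, hA₀⟩ := hne
    have hP0 : ∀ x, P x = p x := fun x => rfl
    refine ⟨P, mem_strongClosedConvexHull_iff.2 fun s ε hε => ?_, fun A hA => ⟨?_, ?_⟩⟩
    · obtain ⟨B, hB, hBs⟩ := IsErgodicLimit.exists_forall_mem_finset hmul hS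
        (subset_convexHull ℝ S hA₀) hε (x := id) (y := p) s fun x _ => hp x
      exact ⟨B * A₀, mul_mem_convexHull hmul hB (subset_convexHull ℝ S hA₀), hBs⟩
    · ext x
      refine eq_of_forall_dist_le fun ε hε => ?_
      obtain ⟨B, hB, hBA⟩ := mem_strongClosedConvexHull_iff.1 hA {P x} ε hε
      have h1 : B (P x) = P x := apply_eq_of_mem_convexHull (hp x).1 hB
      have h2 := hBA (P x) (by simp)
      rw [h1] at h2
      rw [dist_comm, dist_eq_norm]
      exact h2.le
    · ext x
      refine eq_of_forall_dist_le fun ε hε => ?_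
      obtain ⟨B, hB, hBA⟩ := mem_strongClosedConvexHull_iff.1 hA {x} ε hε
      have h1 : p x = p (B x) :=
        ((hp x).apply_left hmul hB).eq ⟨A₀, hA₀⟩ hmul hS (hp (B x))
      have h2 := (hp (A x)).norm_sub_le ⟨A₀, hA₀⟩ hmul hS (hp (B x))
      have h3 := hBA x (by simp)
      rw [dist_eq_norm]
      change ‖p (A x) - p x‖ ≤ ε
      rw [h1]
      rw [norm_sub_rev] at h3
      exact h2.trans h3.le

variable {Y : Type*} [NormedAddCommGroup Y] [NormedSpace ℂ Y]

/-- A convex combination of the `S g` and the combination of the `T g` with the same weights are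
encoded as an element of the convex hull of the pairs `(S g, T g)`. -/
lemma exists_prod_mem_convexHull {G : Type*} {S : G → X →L[ℂ] X} (T : G → Y →L[ℂ] Y)
    {A : X →L[ℂ] X} (hA : A ∈ convexHull ℝ (Set.range S)) :
    ∃ B, (A, B) ∈ convexHull ℝ (Set.range fun g => (S g, T g)) := by
  have h := (LinearMap.fst ℝ (X →L[ℂ] X) (Y →L[ℂ] Y)).image_convexHull
    (Set.range fun g => (S g, T g))
  rw [← Set.range_comp] at h
  obtain ⟨⟨A', B⟩, hAB, rfl⟩ := h.symm.subset hA
  exact ⟨B, hAB⟩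

lemma exists_prod_mem_convexHull' {G : Type*} (S : G → X →L[ℂ] X) {T : G → Y →L[ℂ] Y}
    {B : Y →L[ℂ] Y} (hB : B ∈ convexHull ℝ (Set.range T)) :
    ∃ A, (A, B) ∈ convexHull ℝ (Set.range fun g => (S g, T g)) := by
  have h := (LinearMap.snd ℝ (X →L[ℂ] X) (Y →L[ℂ] Y)).image_convexHull
    (Set.range fun g => (S g, T g))
  rw [← Set.range_comp] at h
  obtain ⟨⟨A, B'⟩, hAB, rfl⟩ := h.symm.subset hB
  exact ⟨A, hAB⟩

lemma mem_convexHull_of_prod {G : Type*} {S : G → X →L[ℂ] X} {T : G → Y →L[ℂ] Y}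
    {A : X →L[ℂ] X} {B : Y →L[ℂ] Y}
    (h : (A, B) ∈ convexHull ℝ (Set.range fun g => (S g, T g))) :
    A ∈ convexHull ℝ (Set.range S) ∧ B ∈ convexHull ℝ (Set.range T) := by
  have h1 := convexHull_mono (𝕜 := ℝ) (t := Set.range S ×ˢ Set.range T) (by
    rintro _ ⟨g, rfl⟩; exact ⟨⟨g, rfl⟩, ⟨g, rfl⟩⟩) h
  rwa [convexHull_prod] at h1

lemma prod_intertwines {G : Type*} {S : G → X →L[ℂ] X} {T : G → Y →L[ℂ] Y} {J : X →L[ℂ] Y}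
    (hJ : ∀ g x, J (S g x) = T g (J x)) {A : X →L[ℂ] X} {B : Y →L[ℂ] Y}
    (h : (A, B) ∈ convexHull ℝ (Set.range fun g => (S g, T g))) (x : X) : J (A x) = B (J x) := by
  refine convexHull_min (t := {q : (X →L[ℂ] X) × (Y →L[ℂ] Y) | J (q.1 x) = q.2 (J x)}) ?_ ?_ h
  · rintro _ ⟨g, rfl⟩; exact hJ g x
  · intro p hp q hq a b _ _ _
    change J (a • p.1 x + b • q.1 x) = a • p.2 (J x) + b • q.2 (J x)
    rw [← hp, ← hq, map_add, J.map_smul_of_tower,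
      J.map_smul_of_tower]

lemma IsErgodicLimit.map {G : Type*} {S : G → X →L[ℂ] X} {T : G → Y →L[ℂ] Y} {J : X →L[ℂ] Y}
    (hJ : ∀ g x, J (S g x) = T g (J x)) {x y : X} (h : IsErgodicLimit (Set.range S) x y) :
    IsErgodicLimit (Set.range T) (J x) (J y) := by
  refine ⟨?_, fun B hB ε hε => ?_⟩
  · rintro _ ⟨g, rfl⟩
    rw [← hJ, h.1 _ ⟨g, rfl⟩]
  · obtain ⟨A, hAB⟩ := exists_prod_mem_convexHull' S hB
    obtain ⟨C, hC, hCx⟩ := h.2 A (mem_convexHull_of_prod hAB).1 (ε / (‖J‖ + 1)) (by positivity)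
    obtain ⟨D, hCD⟩ := exists_prod_mem_convexHull T hC
    refine ⟨D, (mem_convexHull_of_prod hCD).2, ?_⟩
    rw [← prod_intertwines hJ hAB, ← prod_intertwines hJ hCD, ← map_sub]
    rw [lt_div_iff₀ (by positivity)] at hCx
    nlinarith [J.le_opNorm (C (A x) - y), norm_nonneg (C (A x) - y)]

/-- If `X` embeds into a finite power of `Y` by operators `J i` that intertwine `S` with `T`, with
a bounded left inverse given by the `R i`, then ergodic limits in `Y` yield ergodic limits
in `X`. -/
lemma exists_isErgodicLimit_of_intertwines {G ι : Type*} [Fintype ι] {S : G → X →L[ℂ] X}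
    {T : G → Y →L[ℂ] Y} (hne : (Set.range T).Nonempty)
    (hmul : ∀ A ∈ Set.range T, ∀ B ∈ Set.range T, A * B ∈ Set.range T)
    (hT : ∀ A ∈ Set.range T, ‖A‖ ≤ 1) {J : ι → X →L[ℂ] Y} {R : ι → Y →L[ℂ] X}
    (hJ : ∀ i g x, J i (S g x) = T g (J i x)) (hR : ∀ x, ∑ i, R i (J i x) = x)
    (h : ∀ y, ∃ z, IsErgodicLimit (Set.range T) y z) (x : X) :
    ∃ z, IsErgodicLimit (Set.range S) x z := by
  choose p hp using h
  set z : X := ∑ i, R i (p (J i x)) with hz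
  have key : ∀ A ∈ convexHull ℝ (Set.range S), ∀ ε : ℝ, 0 < ε → ∃ B ∈ convexHull ℝ (Set.range S),
      ‖B (A x) - z‖ < ε ∧ ∀ i, ‖J i (B (A x)) - p (J i x)‖ < ε := by
    intro A hA ε hε
    obtain ⟨A', hAA'⟩ := exists_prod_mem_convexHull T hA
    set c : ℝ := ∑ i, ‖R i‖ with hc
    have hc0 : 0 ≤ c := Finset.sum_nonneg fun i _ => norm_nonneg _
    have hδ : 0 < ε / (c + 1) := by positivity
    obtain ⟨B', hB', hBx⟩ := IsErgodicLimit.exists_forall_mem_finset hmul hT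
      (mem_convexHull_of_prod hAA').2 hδ (x := fun i => J i x) (y := fun i => p (J i x))
      Finset.univ fun i _ => hp _
    obtain ⟨B, hBB⟩ := exists_prod_mem_convexHull' S hB'
    have h1 : ∀ i, ‖J i (B (A x)) - p (J i x)‖ < ε / (c + 1) := fun i => by
      rw [prod_intertwines (hJ i) hBB, prod_intertwines (hJ i) hAA']
      exact hBx i (Finset.mem_univ i)
    refine ⟨B, (mem_convexHull_of_prod hBB).1, ?_, fun i => (h1 i).trans_le ?_⟩
    · have h2 : B (A x) - z = ∑ i, R i (J i (B (A x)) - p (J i x)) := by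
        simp only [map_sub, Finset.sum_sub_distrib, hR, hz]
      rw [h2]
      calc _ ≤ ∑ i, ‖R i‖ * (ε / (c + 1)) :=
            norm_sum_le_of_le _ fun i _ => (R i).le_of_opNorm_le_of_le le_rfl (h1 i).le
        _ = c * (ε / (c + 1)) := by rw [Finset.sum_mul]
        _ < ε := by
          rw [mul_div_assoc', div_lt_iff₀ (by positivity)]
          nlinarith
    · exact div_le_self hε.le (by linarith)
  -- the vector `z` is mapped by `J i` to the ergodic limit of `J i x`
  have hJz : ∀ i, J i z = p (J i x) := by
    intro i
    obtain ⟨_, g, rfl⟩ := hne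
    refine eq_of_forall_dist_le fun ε hε => ?_
    have hδ : 0 < ε / (‖J i‖ + 1) := by positivity
    obtain ⟨B, hB, h1, h2⟩ := key (S g) (subset_convexHull ℝ _ ⟨g, rfl⟩) _ hδ
    have h3 := (J i).le_of_opNorm_le_of_le le_rfl h1.le
    have h4 := h2 i
    rw [dist_eq_norm]
    have h5 : J i z - p (J i x) = (J i (B (S g x)) - p (J i x)) - J i (B (S g x) - z) := by
      rw [map_sub]; abel
    rw [h5]
    refine (norm_sub_le _ _).trans ?_
    calc _ ≤ ε / (‖J i‖ + 1) + ‖J i‖ * (ε / (‖J i‖ + 1)) := add_le_add h4.le h3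
      _ = ε := by field_simp; ring
  refine ⟨z, ?_, fun A hA ε hε => ?_⟩
  · rintro _ ⟨g, rfl⟩
    rw [← hR (S g z), hz]
    refine Finset.sum_congr rfl fun i _ => ?_
    rw [← hz, hJ, hJz, (hp _).1 _ ⟨g, rfl⟩]
  · obtain ⟨B, hB, h1, -⟩ := key A hA ε hε
    exact ⟨B, hB, h1⟩

end MeanErgodic

/-! ### Matrix coefficients of unitary representations -/

section PeterWeyl

open MeasureTheory Module

variable {Ω : Type*} [Group Ω]

variable {H : Type*} [NormedAddCommGroup H] [InnerProductSpace ℂ H]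

lemma map_mul_apply (π : Ω →* (H ≃ₗᵢ[ℂ] H)) (x y : Ω) (u : H) : π (x * y) u = π x (π y u) := by
  rw [map_mul]; rfl

lemma inner_map_inv (π : Ω →* (H ≃ₗᵢ[ℂ] H)) (x : Ω) (u v : H) :
    inner ℂ (π x⁻¹ u) v = inner ℂ u (π x v) := by
  rw [← (π x).inner_map_map, ← map_mul_apply, mul_inv_cancel, map_one]
  rfl

/-- The restriction of a unitary representation to an invariant subspace. -/
def restrictRep (π : Ω →* (H ≃ₗᵢ[ℂ] H)) (U : Submodule ℂ H) (hU : ∀ x, ∀ u ∈ U, π x u ∈ U) :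
    Ω →* (U ≃ₗᵢ[ℂ] U) where
  toFun x :=
    { toFun := fun u => ⟨π x u, hU x u u.2⟩
      map_add' := fun u v => Subtype.ext (by simp)
      map_smul' := fun c u => Subtype.ext (by simp)
      invFun := fun u => ⟨π x⁻¹ u, hU x⁻¹ u u.2⟩
      left_inv := fun u => Subtype.ext (by
        change π x⁻¹ (π x u) = u
        rw [← map_mul_apply, inv_mul_cancel, map_one]; rfl)
      right_inv := fun u => Subtype.ext (by
        change π x (π x⁻¹ u) = u
        rw [← map_mul_apply, mul_inv_cancel, map_one]; rfl)
      norm_map' := fun u => (π x).norm_map u }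
  map_one' := by ext u; simp
  map_mul' x y := by ext u; simp

variable [TopologicalSpace Ω]

/-- The set `V` of functions on `Ω` contains every matrix coefficient `x ↦ ⟨v, σ(x) w⟩` of every
irreducible finite-dimensional unitary representation `σ` of `Ω`. -/
def ContainsIrreducibleCoefficients (V : Set C(Ω, ℂ)) : Prop :=
  ∀ (N : ℕ) (σ : Ω →ₜ* UN N), (toRepresentation σ).IsIrreducible → ∀ (w v : CN N) (f : C(Ω, ℂ)),
    (∀ x, f x = inner ℂ v ((σ x : CN N →L[ℂ] CN N) w)) → f ∈ V

/-- A unitary representation on an `N`-dimensional space, written in an orthonormal basis. -/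
def coordinateRep {U : Type*} [NormedAddCommGroup U] [InnerProductSpace ℂ U] {N : ℕ}
    (π : Ω →* (U ≃ₗᵢ[ℂ] U)) (hπ : ∀ u, Continuous fun x => π x u) (b : U ≃ₗᵢ[ℂ] CN N) :
    Ω →ₜ* UN N where
  toFun x := Unitary.linearIsometryEquiv.symm ((b.symm.trans (π x)).trans b)
  map_one' := by
    rw [map_one, ← map_one Unitary.linearIsometryEquiv.symm]
    congr 1
    ext1 v
    simp
  map_mul' x y := by
    rw [map_mul, ← map_mul Unitary.linearIsometryEquiv.symm]
    congr 1
    ext1 v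
    simp
  continuous_toFun := by
    rw [continuous_induced_rng, continuous_clm_apply]
    intro v
    exact b.continuous.comp (hπ (b.symm v))

lemma coordinateRep_apply {U : Type*} [NormedAddCommGroup U] [InnerProductSpace ℂ U] {N : ℕ}
    (π : Ω →* (U ≃ₗᵢ[ℂ] U)) (hπ : ∀ u, Continuous fun x => π x u) (b : U ≃ₗᵢ[ℂ] CN N)
    (x : Ω) (v : CN N) :
    (coordinateRep π hπ b x : CN N →L[ℂ] CN N) v = b (π x (b.symm v)) := rfl

lemma coordinateRep_isIrreducible {U : Type*} [NormedAddCommGroup U] [InnerProductSpace ℂ U]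
    {N : ℕ} (π : Ω →* (U ≃ₗᵢ[ℂ] U)) (hπ : ∀ u, Continuous fun x => π x u) (b : U ≃ₗᵢ[ℂ] CN N)
    [Nontrivial U]
    (hirr : ∀ W : Submodule ℂ U, (∀ x, ∀ w ∈ W, π x w ∈ W) → W = ⊥ ∨ W = ⊤) :
    (toRepresentation (coordinateRep π hπ b)).IsIrreducible where
  exists_pair_ne := by
    refine ⟨⊥, ⊤, fun h => ?_⟩
    have h1 : (⊥ : Submodule ℂ (CN N)) = ⊤ := congrArg Subrepresentation.toSubmodule h
    obtain ⟨u, hu⟩ := exists_ne (0 : U)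
    have h2 : b u ∈ (⊥ : Submodule ℂ (CN N)) := h1 ▸ Submodule.mem_top
    exact hu (b.map_eq_zero_iff.1 ((Submodule.mem_bot ℂ).1 h2))
  eq_bot_or_eq_top S := by
    have hinv : ∀ x, ∀ w ∈ S.toSubmodule.comap b.toLinearEquiv.toLinearMap,
        π x w ∈ S.toSubmodule.comap b.toLinearEquiv.toLinearMap := by
      intro x w hw
      have h1 := S.apply_mem_toSubmodule x hw
      have h2 : toRepresentation (coordinateRep π hπ b) x (b.toLinearEquiv.toLinearMap w)
          = b (π x w) := by
        change b (π x (b.symm (b w))) = _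
        rw [b.symm_apply_apply]
      rw [h2] at h1
      exact h1
    have hmem : ∀ v, v ∈ S.toSubmodule ↔
        b.symm v ∈ S.toSubmodule.comap b.toLinearEquiv.toLinearMap := fun v => by
      rw [Submodule.mem_comap]
      change _ ↔ b (b.symm v) ∈ _
      rw [b.apply_symm_apply]
    rcases hirr _ hinv with h | h
    · left
      refine Subrepresentation.toSubmodule_injective (Submodule.ext fun v => ?_)
      rw [hmem, h, Submodule.mem_bot, b.symm.map_eq_zero_iff]
      exact (Submodule.mem_bot ℂ).symm
    · right
      refine Subrepresentation.toSubmodule_injective (Submodule.ext fun v => ?_)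
      rw [hmem, h]
      exact ⟨fun _ => Submodule.mem_top, fun _ => Submodule.mem_top⟩

/-- Matrix coefficients of vectors in a finite-dimensional invariant subspace are sums of
irreducible matrix coefficients, by complete reducibility. -/
lemma coefficient_mem_of_finiteDimensional {V : Submodule ℂ C(Ω, ℂ)}
    (hV : ContainsIrreducibleCoefficients (V : Set C(Ω, ℂ))) {π : Ω →* (H ≃ₗᵢ[ℂ] H)}
    (hπ : ∀ u, Continuous fun x => π x u) (n : ℕ) (U : Submodule ℂ H) [FiniteDimensional ℂ U]
    (hn : finrank ℂ U = n) (hU : ∀ x, ∀ u ∈ U, π x u ∈ U) {w : H} (hw : w ∈ U) (v : H)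
    (f : C(Ω, ℂ)) (hf : ∀ x, f x = inner ℂ v (π x w)) : f ∈ V := by
  induction n using Nat.strong_induction_on generalizing U w f with
  | _ n ih =>
  -- either `U` is irreducible, or it splits into an invariant subspace and its complement
  by_cases hirr : ∀ W : Submodule ℂ H, W ≤ U → (∀ x, ∀ w ∈ W, π x w ∈ W) → W = ⊥ ∨ W = U
  · by_cases hw0 : w = 0
    · have : f = 0 := by ext x; simp [hf, hw0]
      rw [this]; exact V.zero_mem
    have : Nontrivial U := ⟨⟨w, hw⟩, 0, fun h => hw0 (congrArg Subtype.val h)⟩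
    set ρ := restrictRep π U hU with hρ
    have hρc : ∀ u, Continuous fun x => ρ x u := fun u =>
      Continuous.subtype_mk (hπ u) fun x => hU x u u.2
    let b : U ≃ₗᵢ[ℂ] CN (finrank ℂ U) := (stdOrthonormalBasis ℂ U).repr
    refine hV _ (coordinateRep ρ hρc b) (coordinateRep_isIrreducible ρ hρc b fun W hW => ?_)
      (b ⟨w, hw⟩) (b (U.orthogonalProjectionOnto v)) f fun x => ?_
    · rcases hirr (W.map U.subtype) (Submodule.map_subtype_le U W) (by
        rintro x _ ⟨u, hu, rfl⟩
        exact ⟨ρ x u, hW x u hu, rfl⟩) with h | h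
      · left
        exact Submodule.map_injective_of_injective U.subtype_injective
          (by rw [h, Submodule.map_bot])
      · right
        refine Submodule.map_injective_of_injective U.subtype_injective ?_
        rw [h, Submodule.map_top, Submodule.range_subtype]
    · rw [coordinateRep_apply, b.symm_apply_apply, b.inner_map_map, hf]
      have h1 := U.inner_orthogonalProjectionOnto_eq_of_mem_right (ρ x ⟨w, hw⟩) v
      rw [Submodule.coe_inner] 
      exact h1.symm
  · push Not at hirr
    obtain ⟨W, hWU, hWinv, hW0, hW1⟩ := hirr
    have : FiniteDimensional ℂ W := Submodule.finiteDimensional_of_le hWU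
    have : FiniteDimensional ℂ (U ⊓ Wᗮ : Submodule ℂ H) :=
      Submodule.finiteDimensional_of_le inf_le_left
    have hlt : W < U := lt_of_le_of_ne hWU hW1
    have hlt' : U ⊓ Wᗮ < U := by
      refine lt_of_le_of_ne inf_le_left fun h => hW0 ?_
      rw [eq_bot_iff]
      intro z hz
      have h1 : z ∈ Wᗮ := (h.ge (hWU hz)).2
      exact (Submodule.mem_bot ℂ).2 (inner_self_eq_zero.1 (h1 z hz))
    have hinv' : ∀ x, ∀ u ∈ U ⊓ Wᗮ, π x u ∈ U ⊓ Wᗮ := fun x u hu =>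
      ⟨hU x u hu.1, fun z hz => by
        rw [← inner_map_inv]
        exact hu.2 _ (hWinv x⁻¹ z hz)⟩
    set p : H := W.starProjection w with hp
    have hpW : p ∈ W := W.starProjection_apply_mem w
    have hq : w - p ∈ U ⊓ Wᗮ :=
      ⟨U.sub_mem hw (hWU hpW), W.sub_starProjection_mem_orthogonal w⟩
    have h1 := ih _ (hn ▸ Submodule.finrank_lt_finrank_of_lt hlt) W rfl hWinv hpW
      ⟨fun x => inner ℂ v (π x p), continuous_const.inner (hπ p)⟩ fun x => rfl
    have h2 := ih _ (hn ▸ Submodule.finrank_lt_finrank_of_lt hlt') (U ⊓ Wᗮ) rfl hinv' hq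
      ⟨fun x => inner ℂ v (π x (w - p)), continuous_const.inner (hπ _)⟩ fun x => rfl
    convert V.add_mem h1 h2 using 1
    ext x
    simp [hf]

variable [IsTopologicalGroup Ω] [CompactSpace Ω]

/-- In a unitary representation of a compact group, every nonzero vector fails to be orthogonal to
some finite-dimensional invariant subspace: averaging the rank-one operator of the vector over the
group yields a nonzero compact self-adjoint operator that commutes with the group, and its
eigenspaces are invariant. -/
lemma eq_zero_of_orthogonal_finiteDimensional_invariant [CompleteSpace H] {π : Ω →* (H ≃ₗᵢ[ℂ] H)}
    (hπ : ∀ u, Continuous fun x => π x u) {u : H}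
    (hu : ∀ U : Submodule ℂ H, FiniteDimensional ℂ U → (∀ x, ∀ w ∈ U, π x w ∈ U) →
      ∀ w ∈ U, inner ℂ u w = 0) : u = 0 := by
  let _ : MeasurableSpace Ω := borel Ω
  have : BorelSpace Ω := ⟨rfl⟩
  let μ : Measure Ω := Measure.haarMeasure ⊤
  have : IsProbabilityMeasure μ := ⟨Measure.haarMeasure_self⟩
  by_contra hu0
  let q : Ω → H →L[ℂ] H := fun x => InnerProductSpace.rankOne ℂ (π x u) (π x u)
  have hq : Continuous q :=
    ((ContinuousLinearMap.smulRightL ℂ H H).continuous.comp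
      ((innerSL ℂ).continuous.comp (hπ u))).clm_apply (hπ u)
  have hqi : Integrable q μ :=
    hq.integrable_of_hasCompactSupport (HasCompactSupport.of_compactSpace q)
  let T : H →L[ℂ] H := ∫ x, q x ∂μ
  have hT : ∀ w, T w = ∫ x, (inner ℂ (π x u) w : ℂ) • π x u ∂μ := fun w =>
    ContinuousLinearMap.integral_apply hqi w
  have hTmem : T ∈ {A : H →L[ℂ] H | IsCompactOperator A} ∩
      {A | ∀ w z, inner ℂ (A w) z = inner ℂ w (A z)} := by
    refine Convex.integral_mem (Convex.inter ?_ ?_) (IsClosed.inter ?_ ?_)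
      (Filter.Eventually.of_forall fun x => ⟨?_, fun w z => ?_⟩) hqi
    · intro A hA B hB a b _ _ _
      exact (hA.smul a).add (hB.smul b)
    · intro A hA B hB a b _ _ _ w z
      have h1 := hA w z
      have h2 := hB w z
      simp only [add_apply, smul_apply, inner_add_left,
        inner_add_right, ← Complex.coe_smul, inner_smul_left, inner_smul_right, h1, h2,
        Complex.conj_ofReal]
    · exact isClosed_setOfPred_isCompactOperator
    · simp only [Set.ofPred_forall]
      refine isClosed_iInter fun w => isClosed_iInter fun z => isClosed_eq ?_ ?_
      · exact ((ContinuousLinearMap.apply ℂ H w).continuous).inner continuous_const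
      · exact continuous_const.inner (ContinuousLinearMap.apply ℂ H z).continuous
    · have h1 : IsCompactOperator (ContinuousLinearMap.toSpanSingleton ℂ (π x u) : ℂ →L[ℂ] H) :=
        isCompactOperator_of_locallyCompactSpace_rng _
      exact h1.comp_clm (innerSL ℂ (π x u))
    · simp only [q, InnerProductSpace.rankOne_apply, inner_smul_left, inner_smul_right,
        inner_conj_symm]
      ring
  -- invariance of the Haar measure
  have hcomm : ∀ y w, T (π y w) = π y (T w) := by
    intro y w
    have h1 : π y (T w) = ∫ x, π y ((inner ℂ (π x u) w : ℂ) • π x u) ∂μ := by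
      rw [hT]
      exact ((π y).toContinuousLinearEquiv.integral_comp_comm _).symm
    rw [h1, hT, ← integral_mul_left_eq_self _ y]
    refine integral_congr_ae (Filter.Eventually.of_forall fun x => ?_)
    simp only [map_mul_apply, LinearIsometryEquiv.inner_map_map, map_smul]
  have hT0 : T ≠ 0 := by
    intro h
    have h1 : inner ℂ u (T u) = ∫ x, ((‖(inner ℂ (π x u) u : ℂ)‖ ^ 2 : ℝ) : ℂ) ∂μ := by
      rw [hT, ← innerSL_apply_apply ℂ, ← ContinuousLinearMap.integral_comp_comm]
      · refine integral_congr_ae (Filter.Eventually.of_forall fun x => ?_)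
        simp only [innerSL_apply_apply, inner_smul_right]
        rw [← inner_conj_symm u]
        exact (RCLike.mul_conj _).trans (by simp)
      · have := ((ContinuousLinearMap.apply ℂ H u).integrable_comp hqi)
        exact this
    rw [h, zero_apply, inner_zero_right, integral_complex_ofReal] at h1
    have hc : Continuous fun x => ‖(inner ℂ (π x u) u : ℂ)‖ ^ 2 :=
      (((hπ u).inner continuous_const).norm).pow 2
    have h2 : 0 < ∫ x, ‖(inner ℂ (π x u) u : ℂ)‖ ^ 2 ∂μ :=
      hc.integral_pos_of_hasCompactSupport_nonneg_nonzero (x := 1)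
        (HasCompactSupport.of_compactSpace _) (fun x => by positivity) (by simpa using hu0)
    exact h2.ne' (by exact_mod_cast h1.symm)
  have hTs : T.IsSymmetric := hTmem.2
  have hex := (ContinuousLinearMap.eq_zero_of_forall_hasEigenvalue_eq_zero hTmem.1 hTs).not.2 hT0
  push Not at hex
  obtain ⟨c, hc, hc0⟩ := hex
  obtain ⟨e, he, he0⟩ := hc.exists_hasEigenvector
  have hfd := ContinuousLinearMap.finite_dimensional_eigenspace hTmem.1 c hc0
  have hinv : ∀ x, ∀ w ∈ End.eigenspace T.toLinearMap c,
      π x w ∈ End.eigenspace T.toLinearMap c := by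
    intro x w hw
    rw [End.mem_eigenspace_iff] at hw ⊢
    change T w = c • w at hw
    change T (π x w) = c • π x w
    rw [hcomm, hw, map_smul]
  -- `T e` is an average of multiples of `inner (π x u) e = inner u (π x⁻¹ e) = 0`
  have hTe : T e = 0 := by
    rw [hT]
    refine integral_eq_zero_of_ae (Filter.Eventually.of_forall fun x => ?_)
    have h1 : inner ℂ (π x u) e = inner ℂ u (π x⁻¹ e) := by
      rw [← inner_map_inv, inv_inv]
    simp only [h1, hu _ hfd hinv _ (hinv x⁻¹ e he), zero_smul, Pi.zero_apply]
  have h2 : T e = c • e := End.mem_eigenspace_iff.1 he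
  rw [hTe] at h2
  exact (smul_ne_zero hc0 he0) h2.symm

/-- Every matrix coefficient of a strongly continuous unitary representation of a compact group is
a uniform limit of sums of irreducible matrix coefficients. -/
lemma coefficient_mem [CompleteSpace H] {V : Submodule ℂ C(Ω, ℂ)} (hVc : IsClosed (V : Set C(Ω, ℂ)))
    (hV : ContainsIrreducibleCoefficients (V : Set C(Ω, ℂ))) {π : Ω →* (H ≃ₗᵢ[ℂ] H)}
    (hπ : ∀ u, Continuous fun x => π x u) (w v : H)
    (f : C(Ω, ℂ)) (hf : ∀ x, f x = inner ℂ v (π x w)) : f ∈ V := by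
  let C : H →L[ℂ] C(Ω, ℂ) := LinearMap.mkContinuous
    { toFun := fun w => ⟨fun x => inner ℂ v (π x w), continuous_const.inner (hπ w)⟩
      map_add' := fun w z => by ext x; simp
      map_smul' := fun c w => by ext x; simp } ‖v‖
    fun w => (ContinuousMap.norm_le _ (by positivity)).2 fun x => by
      simpa using norm_inner_le_norm (𝕜 := ℂ) v (π x w)
  have hfC : f = C w := by ext x; exact hf x
  let W : Submodule ℂ H := V.comap C.toLinearMap
  have hWc : IsClosed (W : Set H) := hVc.preimage C.continuous
  have hW : W = ⊤ := by
    rw [← hWc.submodule_topologicalClosure_eq, Submodule.topologicalClosure_eq_top_iff,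
      Submodule.eq_bot_iff]
    intro u hu
    refine eq_zero_of_orthogonal_finiteDimensional_invariant hπ fun U hfd hU w hw => ?_
    rw [← inner_conj_symm, hu w, map_zero]
    exact coefficient_mem_of_finiteDimensional hV hπ _ U rfl hU hw v _ fun x => rfl
  have : w ∈ W := hW ▸ Submodule.mem_top
  rw [hfC]
  exact this

/-- The left regular representation `(x f)(y) = f(x⁻¹ y)` of a group on `L²`. -/
def regularRep [MeasurableSpace Ω] [BorelSpace Ω] (μ : Measure Ω) [μ.IsMulLeftInvariant] :
    Ω →* (Lp ℂ 2 μ ≃ₗᵢ[ℂ] Lp ℂ 2 μ) where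
  toFun x :=
    { toFun := fun f => DomMulAct.mk x⁻¹ • f
      map_add' := fun f g => smul_add _ f g
      map_smul' := fun c f => smul_comm _ c f
      invFun := fun f => DomMulAct.mk x • f
      left_inv := fun f => by
        change DomMulAct.mk x • DomMulAct.mk x⁻¹ • f = f
        rw [smul_smul, ← DomMulAct.mk_mul, inv_mul_cancel, DomMulAct.mk_one, one_smul]
      right_inv := fun f => by
        change DomMulAct.mk x⁻¹ • DomMulAct.mk x • f = f
        rw [smul_smul, ← DomMulAct.mk_mul, mul_inv_cancel, DomMulAct.mk_one, one_smul]
      norm_map' := fun f => DomMulAct.norm_smul_Lp _ f }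
  map_one' := by
    ext1 f
    change DomMulAct.mk (1 : Ω)⁻¹ • f = f
    rw [inv_one, DomMulAct.mk_one, one_smul]
  map_mul' x y := by
    ext1 f
    change DomMulAct.mk (x * y)⁻¹ • f = DomMulAct.mk x⁻¹ • DomMulAct.mk y⁻¹ • f
    rw [smul_smul, ← DomMulAct.mk_mul, mul_inv_rev]

/-- The **Peter–Weyl theorem**: the matrix coefficients of the irreducible finite-dimensional
unitary representations of a compact group span a dense subspace of the continuous functions. Any
function `f` is approximated by the coefficients of the regular representation given by `x ↦ f(x⁻¹)`
and the normalized indicator function of a small neighbourhood of `1`. -/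
theorem peterWeyl {V : Submodule ℂ C(Ω, ℂ)} (hVc : IsClosed (V : Set C(Ω, ℂ)))
    (hV : ContainsIrreducibleCoefficients (V : Set C(Ω, ℂ))) : V = ⊤ := by
  let _ : MeasurableSpace Ω := borel Ω
  have : BorelSpace Ω := ⟨rfl⟩
  let μ : Measure Ω := Measure.haarMeasure ⊤
  rw [eq_top_iff]
  intro f _
  rw [← SetLike.mem_coe, ← hVc.closure_eq, Metric.mem_closure_iff]
  intro ε hε
  -- translates `f (y⁻¹ ·)` with `y` in the neighbourhood `W` of `1` are uniformly close to `f`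
  let F : C(Ω, C(Ω, ℂ)) := ContinuousMap.curry
    ⟨fun p : Ω × Ω => f (p.1⁻¹ * p.2), by fun_prop⟩
  have hF : ∀ y x, F y x = f (y⁻¹ * x) := fun y x => rfl
  let W : Set Ω := F ⁻¹' Metric.ball f (ε / 2)
  have hWo : IsOpen W := Metric.isOpen_ball.preimage F.continuous
  have hW1 : (1 : Ω) ∈ W := by
    have : F 1 = f := by ext x; simp [hF]
    change F 1 ∈ Metric.ball f (ε / 2)
    rw [this]
    exact Metric.mem_ball_self (half_pos hε)
  have hWpos : 0 < μ.real W :=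
    ENNReal.toReal_pos (hWo.measure_pos μ ⟨1, hW1⟩).ne' (measure_ne_top μ W)
  -- inversion turns the left translates of the regular representation into functions
  -- `x ↦ f (y⁻¹ x)` of the group variable
  let f' : C(Ω, ℂ) := f.comp ⟨fun x => x⁻¹, continuous_inv⟩
  have hmem : ∀ g : C(Ω, ℂ), MemLp g 2 μ := fun g =>
    g.continuous.memLp_of_hasCompactSupport (HasCompactSupport.of_compactSpace g)
  have : Fact ((2 : ENNReal) ≠ ⊤) := ⟨by simp⟩
  have hπ : ∀ u, Continuous fun x => regularRep μ x u := fun u =>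
    (DomMulAct.continuous_mk.comp continuous_inv).smul continuous_const
  let v : Lp ℂ 2 μ := indicatorConstLp 2 hWo.measurableSet (measure_ne_top μ W) (1 : ℂ)
  let c : C(Ω, ℂ) := ⟨fun x => inner ℂ v (regularRep μ x ((hmem f').toLp)),
    continuous_const.inner (hπ _)⟩
  have hcV : c ∈ V := coefficient_mem hVc hV hπ ((hmem f').toLp) v c fun x => rfl
  have hc : ∀ x, c x = ∫ y in W, F y x ∂μ := by
    intro x
    change inner ℂ v (DomMulAct.mk x⁻¹ • (hmem f').toLp) = _
    rw [DomMulAct.mk_smul_toLp, L2.inner_indicatorConstLp_one]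
    refine setIntegral_congr_ae hWo.measurableSet ?_
    filter_upwards [MemLp.coeFn_toLp ((hmem f').comp_measurePreserving
      (measurePreserving_smul x⁻¹ μ))] with y hy _
    refine hy.trans ?_
    simp [hF, f']
  refine ⟨((μ.real W)⁻¹ : ℂ) • c, V.smul_mem _ hcV, ?_⟩
  rw [dist_eq_norm]
  refine lt_of_le_of_lt ((ContinuousMap.norm_le _ (half_pos hε).le).2 fun x => ?_)
    (half_lt_self hε)
  have hFi : IntegrableOn (fun y => F y x) W μ := by
    have : Continuous fun y => F y x := by simp only [hF]; fun_prop
    exact (this.integrable_of_hasCompactSupport (HasCompactSupport.of_compactSpace _)).integrableOn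
  have h1 : (f - ((μ.real W)⁻¹ : ℂ) • c) x = ((μ.real W)⁻¹ : ℂ) * ∫ y in W, (f x - F y x) ∂μ := by
    rw [integral_sub (integrable_const _) hFi, setIntegral_const, ← hc]
    have : (μ.real W : ℂ) ≠ 0 := by exact_mod_cast hWpos.ne'
    simp [mul_sub, this]
  have h2 : ‖∫ y in W, (f x - F y x) ∂μ‖ ≤ ε / 2 * μ.real W := by
    refine norm_setIntegral_le_of_norm_le_const (measure_lt_top μ W) fun y hy => ?_
    have hy' : dist (F y) f < ε / 2 := hy
    rw [norm_sub_rev]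
    rw [dist_eq_norm] at hy'
    exact ((F y - f).norm_coe_le_norm x).trans hy'.le
  rw [h1, norm_mul, norm_inv, Complex.norm_real, Real.norm_of_nonneg hWpos.le,
    inv_mul_le_iff₀ hWpos]
  linarith

end PeterWeyl

/-! ### Functions on products -/

lemma exists_continuousMap_ne {Z : Type*} [TopologicalSpace Z] [CompactSpace Z] [T2Space Z]
    {z z' : Z} (hz : z ≠ z') : ∃ a : C(Z, ℂ), a z ≠ a z' := by
  obtain ⟨f, h0, h1, -⟩ := exists_continuous_zero_one_of_isClosed
    (isClosed_singleton (x := z)) (isClosed_singleton (x := z')) (by simpa using hz)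
  refine ⟨⟨fun t => (f t : ℂ), by fun_prop⟩, ?_⟩
  change (f z : ℂ) ≠ (f z' : ℂ)
  rw [h0 (Set.mem_singleton z), h1 (Set.mem_singleton z')]
  simp

/-- By the Stone–Weierstrass theorem, the products `a(x) b(y)` span a dense subspace of
`C(X × Y)`. -/
lemma eq_top_of_forall_mul_mem {X Y : Type*} [TopologicalSpace X] [CompactSpace X] [T2Space X]
    [TopologicalSpace Y] [CompactSpace Y] [T2Space Y] {V : Submodule ℂ C(X × Y, ℂ)}
    (hVc : IsClosed (V : Set C(X × Y, ℂ)))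
    (hV : ∀ (a : C(X, ℂ)) (b : C(Y, ℂ)), a.comp .fst * b.comp .snd ∈ V) : V = ⊤ := by
  let s : Set C(X × Y, ℂ) := {f | ∃ (a : C(X, ℂ)) (b : C(Y, ℂ)), f = a.comp .fst * b.comp .snd}
  have hmul : ∀ f ∈ Submodule.span ℂ s, ∀ g ∈ Submodule.span ℂ s,
      f * g ∈ Submodule.span ℂ s := by
    intro f hf g hg
    have h1 := Submodule.mul_mem_mul hf hg
    rw [Submodule.span_mul_span] at h1
    refine Submodule.span_mono ?_ h1
    rintro _ ⟨_, ⟨a, b, rfl⟩, _, ⟨a', b', rfl⟩, rfl⟩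
    exact ⟨a * a', b * b', by ext p; simp; ring⟩
  let A : StarSubalgebra ℂ C(X × Y, ℂ) :=
    { carrier := Submodule.span ℂ s
      mul_mem' := fun {f g} hf hg => hmul f hf g hg
      add_mem' := fun hf hg => Submodule.add_mem _ hf hg
      algebraMap_mem' := fun c => by
        rw [Algebra.algebraMap_eq_smul_one]
        exact Submodule.smul_mem _ c (Submodule.subset_span ⟨1, 1, by ext p; simp⟩)
      star_mem' := fun {f} hf => by
        induction hf using Submodule.span_induction with
        | mem f hf =>
          obtain ⟨a, b, rfl⟩ := hf
          exact Submodule.subset_span ⟨star a, star b, by ext p; simp⟩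
        | zero => rw [star_zero]; exact Submodule.zero_mem _
        | add f g _ _ hf hg => rw [star_add]; exact Submodule.add_mem _ hf hg
        | smul c f _ hf => rw [star_smul]; exact Submodule.smul_mem _ _ hf }
  have hsep : A.SeparatesPoints := by
    rintro ⟨x, y⟩ ⟨x', y'⟩ hne
    by_cases hx : x = x'
    · have hy : y ≠ y' := fun hy => hne (by rw [hx, hy])
      obtain ⟨b, hb⟩ := exists_continuousMap_ne hy
      exact ⟨_, ⟨(1 : C(X, ℂ)).comp .fst * b.comp .snd,
        Submodule.subset_span ⟨1, b, rfl⟩, rfl⟩, by simpa using hb⟩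
    · obtain ⟨a, ha⟩ := exists_continuousMap_ne hx
      exact ⟨_, ⟨a.comp .fst * (1 : C(Y, ℂ)).comp .snd,
        Submodule.subset_span ⟨a, 1, rfl⟩, rfl⟩, by simpa using ha⟩
  have htop := ContinuousMap.starSubalgebra_topologicalClosure_eq_top_of_separatesPoints A hsep
  rw [eq_top_iff]
  intro f _
  have hf : f ∈ A.topologicalClosure := htop ▸ StarSubalgebra.mem_top
  have hAV : (A : Set C(X × Y, ℂ)) ⊆ V :=
    Submodule.span_le.2 (by rintro _ ⟨a, b, rfl⟩; exact hV a b)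
  exact closure_minimal hAV hVc hf

/-! ### Skew products and twisted Koopman semigroups -/

lemma koopman_mul {G X E : Type*} [Semigroup G] [TopologicalSpace X] [CompactSpace X]
    [SemigroupAction G X] [ContinuousConstSMul G X] [NormedAddCommGroup E] [NormedSpace ℂ E] (g h : G) :
    koopman X E g * koopman X E h = koopman X E (h * g) := by
  ext f x
  change f (h • g • x) = f ((h * g) • x)
  rw [mul_smul]

lemma norm_koopman_le {G X E : Type*} [Semigroup G] [TopologicalSpace X] [CompactSpace X]
    [SemigroupAction G X] [ContinuousConstSMul G X] [NormedAddCommGroup E] [NormedSpace ℂ E] (g : G) :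
    ‖koopman X E g‖ ≤ 1 :=
  LinearMap.mkContinuous_norm_le _ zero_le_one _

section SkewProduct

variable {G K Ω : Type*} [Semigroup G] [TopologicalSpace G]
  [TopologicalSpace K] [CompactSpace K] [SemigroupAction G K] [Group Ω] [TopologicalSpace Ω]

lemma twistedKoopman_mul [ContinuousConstSMul G K] {N : ℕ} (γ : ContinuousCocycle G K (UN N)) (g h : G) :
    twistedKoopman γ g * twistedKoopman γ h = twistedKoopman γ (h * g) := by
  refine ContinuousLinearMap.ext fun f => ContinuousMap.ext fun x => ?_
  change (γ.toFun g x : CN N →L[ℂ] CN N) ((γ.toFun h (g • x) : CN N →L[ℂ] CN N) (f (h • g • x))) =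
    (γ.toFun (h * g) x : CN N →L[ℂ] CN N) (f ((h * g) • x))
  rw [γ.cocycle, mul_smul]
  rfl

lemma norm_twistedKoopman_le [ContinuousConstSMul G K] {N : ℕ} (γ : ContinuousCocycle G K (UN N)) (g : G) :
    ‖twistedKoopman γ g‖ ≤ 1 :=
  LinearMap.mkContinuous_norm_le _ zero_le_one _

variable [CompactSpace Ω]

/-- For a unitary representation `π` and a vector `v`, the operator
`f ↦ ((x, ω) ↦ ⟨v, π(ω) f(x)⟩)` from `C(K, ℂ^N)` to the functions on the skew product. -/
def coefficientMap (γ : ContinuousCocycle G K Ω) {N : ℕ} (π : Ω →ₜ* UN N) (v : CN N) :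
    C(K, CN N) →L[ℂ] C(SkewProduct γ, ℂ) :=
  LinearMap.mkContinuous
    { toFun := fun f => ⟨fun p : K × Ω => inner ℂ v ((π p.2 : CN N →L[ℂ] CN N) (f p.1)),
        continuous_const.inner
          (((continuous_subtype_val.comp π.continuous_toFun).comp continuous_snd).clm_apply
            (f.continuous.comp continuous_fst))⟩
      map_add' := fun f g => by
        refine ContinuousMap.ext fun p => ?_
        change inner ℂ v ((π p.2 : CN N →L[ℂ] CN N) (f p.1 + g p.1)) = _
        rw [map_add, inner_add_right]
        rfl
      map_smul' := fun c f => by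
        refine ContinuousMap.ext fun p => ?_
        change inner ℂ v ((π p.2 : CN N →L[ℂ] CN N) (c • f p.1)) = _
        rw [map_smul, inner_smul_right]
        rfl } ‖v‖
    fun f => (ContinuousMap.norm_le _ (by positivity)).2 fun p => by
      refine (norm_inner_le_norm (𝕜 := ℂ) v ((π p.2 : CN N →L[ℂ] CN N) (f p.1))).trans ?_
      rw [Unitary.norm_map (π p.2)]
      exact mul_le_mul_of_nonneg_left (f.norm_coe_le_norm p.1) (norm_nonneg v)

lemma coefficientMap_twistedKoopman [ContinuousSMul G K] [IsTopologicalGroup Ω]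
    (γ : ContinuousCocycle G K Ω) {N : ℕ} (π : Ω →ₜ* UN N) (v : CN N) (g : G) (f : C(K, CN N)) :
    coefficientMap γ π v (twistedKoopman (γ.map π) g f) =
      koopman (SkewProduct γ) ℂ g (coefficientMap γ π v f) := by
  refine ContinuousMap.ext fun p => ?_
  change inner ℂ v ((π p.2 : CN N →L[ℂ] CN N)
      ((π (γ.toFun g p.1) : CN N →L[ℂ] CN N) (f (g • p.1)))) =
    inner ℂ v ((π (p.2 * γ.toFun g p.1) : CN N →L[ℂ] CN N) (f (g • p.1)))
  rw [show π (p.2 * γ.toFun g p.1) = π p.2 * π (γ.toFun g p.1) from π.map_mul' _ _]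
  rfl

/-- The operator `F ↦ (x ↦ F(x, 1) v)`. -/
def sliceMap (γ : ContinuousCocycle G K Ω) {N : ℕ} (v : CN N) :
    C(SkewProduct γ, ℂ) →L[ℂ] C(K, CN N) :=
  LinearMap.mkContinuous
    { toFun := fun F => ⟨fun x : K => F ((x, 1) : K × Ω) • v,
        (F.continuous.comp (continuous_id.prodMk continuous_const)).smul continuous_const⟩
      map_add' := fun F F' => ContinuousMap.ext fun x => add_smul (F (x, 1)) (F' (x, 1)) v
      map_smul' := fun c F => ContinuousMap.ext fun x => mul_smul c (F (x, 1)) v } ‖v‖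
    fun F => (ContinuousMap.norm_le _ (by positivity)).2 fun x => by
      change ‖F ((x, 1) : K × Ω) • v‖ ≤ _
      rw [norm_smul, mul_comm]
      exact mul_le_mul_of_nonneg_left (F.norm_coe_le_norm _) (norm_nonneg v)

lemma sum_sliceMap_coefficientMap (γ : ContinuousCocycle G K Ω) {N : ℕ} (π : Ω →ₜ* UN N)
    (f : C(K, CN N)) :
    ∑ i, sliceMap γ (EuclideanSpace.basisFun (Fin N) ℂ i)
      (coefficientMap γ π (EuclideanSpace.basisFun (Fin N) ℂ i) f) = f := by
  refine ContinuousMap.ext fun x => ?_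
  rw [ContinuousMap.sum_apply]
  have h1 : (π 1 : CN N →L[ℂ] CN N) (f x) = f x := by
    rw [show π 1 = 1 from π.map_one']; rfl
  refine (Finset.sum_congr rfl fun i _ => ?_).trans
    ((EuclideanSpace.basisFun (Fin N) ℂ).sum_repr' (f x))
  change (inner ℂ _ ((π 1 : CN N →L[ℂ] CN N) (f x)) : ℂ) •
    EuclideanSpace.basisFun (Fin N) ℂ i = _
  rw [h1]

lemma eq_top_of_forall_coefficientMap_mem [IsTopologicalGroup Ω] [T2Space Ω] [T2Space K]
    (γ : ContinuousCocycle G K Ω) {V : Submodule ℂ C(SkewProduct γ, ℂ)}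
    (hVc : IsClosed (V : Set C(SkewProduct γ, ℂ)))
    (hV : ∀ (N : ℕ) (π : Ω →ₜ* UN N), (toRepresentation π).IsIrreducible → ∀ v f,
      coefficientMap γ π v f ∈ V) : V = ⊤ := by
  refine eq_top_of_forall_mul_mem (X := K) (Y := Ω) (V := V) hVc fun a b => ?_
  -- for fixed `a`, the functions `b` for which the product lies in `V` form a closed subspace
  let M : C(Ω, ℂ) →L[ℂ] C(K × Ω, ℂ) := LinearMap.mkContinuous
    { toFun := fun b => a.comp .fst * b.comp .snd
      map_add' := fun b b' => by ext p; simp [mul_add]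
      map_smul' := fun c b => by ext p; simp } ‖a‖
    fun b => (ContinuousMap.norm_le _ (by positivity)).2 fun p => by
      change ‖a p.1 * b p.2‖ ≤ _
      rw [norm_mul]
      exact mul_le_mul (a.norm_coe_le_norm _) (b.norm_coe_le_norm _) (norm_nonneg _) (norm_nonneg _)
  let W : Submodule ℂ C(Ω, ℂ) := Submodule.comap M.toLinearMap V
  have hWc : IsClosed (W : Set C(Ω, ℂ)) := IsClosed.preimage M.continuous hVc
  have hW : W = ⊤ := by
    refine peterWeyl hWc fun N σ hσ w v f hf => ?_
    have h1 := hV N σ hσ v ⟨fun x => a x • w, a.continuous.smul continuous_const⟩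
    have h2 : coefficientMap γ σ v ⟨fun x => a x • w, a.continuous.smul continuous_const⟩ =
        M f := by
      refine ContinuousMap.ext fun p => ?_
      change inner ℂ v ((σ p.2 : CN N →L[ℂ] CN N) (a p.1 • w)) = a p.1 * f p.2
      rw [map_smul, inner_smul_right, hf]
    rw [h2] at h1
    exact h1
  have : b ∈ W := hW ▸ Submodule.mem_top
  exact this

end SkewProduct

end GroupExtension

end

/-! ### Mean ergodicity of skew products -/

theorem mainTheorem5 {G K Ω : Type*}
    [Semigroup G] [TopologicalSpace G] [SeparatelyContinuousMul G]
    (hG : GroupExtension.RightAmenable G)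
    [TopologicalSpace K] [CompactSpace K] [T2Space K]
    [SemigroupAction G K] [ContinuousSMul G K]
    [Group Ω] [TopologicalSpace Ω] [IsTopologicalGroup Ω] [CompactSpace Ω] [T2Space Ω]
    (γ : GroupExtension.ContinuousCocycle G K Ω) :
    GroupExtension.IsMeanErgodic
        (Set.range fun g : G => GroupExtension.koopman (GroupExtension.SkewProduct γ) ℂ g) ↔
      ∀ (N : ℕ) (π : Ω →ₜ* GroupExtension.UN N),
        (GroupExtension.toRepresentation π).IsIrreducible →
          GroupExtension.IsMeanErgodic
            (Set.range fun g : G => GroupExtension.twistedKoopman (γ.map π) g) := by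
  open GroupExtension in
  -- on the empty semigroup the constant function `1` is `0`, so no functional maps it to `1`
  have hne : Nonempty G := by
    by_contra h
    rw [not_nonempty_iff] at h
    obtain ⟨m, ⟨h1, -⟩, -⟩ := hG
    have h2 : BoundedContinuousFunction.const G (1 : ℂ) = 0 := by
      ext g
      exact h.elim g
    rw [h2, map_zero] at h1
    exact zero_ne_one h1
  have hmul : ∀ A ∈ Set.range fun g : G => koopman (SkewProduct γ) ℂ g,
      ∀ B ∈ Set.range fun g : G => koopman (SkewProduct γ) ℂ g,
        A * B ∈ Set.range fun g : G => koopman (SkewProduct γ) ℂ g := by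
    rintro _ ⟨g, rfl⟩ _ ⟨h, rfl⟩
    exact ⟨h * g, (koopman_mul g h).symm⟩
  have hle : ∀ A ∈ Set.range fun g : G => koopman (SkewProduct γ) ℂ g, ‖A‖ ≤ 1 := by
    rintro _ ⟨g, rfl⟩
    exact norm_koopman_le g
  have hT := isMeanErgodic_iff_forall_exists_isErgodicLimit (Set.range_nonempty _) hmul hle
  have hS : ∀ (N : ℕ) (π : Ω →ₜ* UN N),
      IsMeanErgodic (Set.range fun g : G => twistedKoopman (γ.map π) g) ↔ _ := fun N π =>
    isMeanErgodic_iff_forall_exists_isErgodicLimit (Set.range_nonempty _)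
      (by rintro _ ⟨g, rfl⟩ _ ⟨h, rfl⟩; exact ⟨h * g, (twistedKoopman_mul _ g h).symm⟩)
      (by rintro _ ⟨g, rfl⟩; exact norm_twistedKoopman_le _ g)
  constructor
  · intro h N π _
    rw [hS]
    rw [hT] at h
    exact exists_isErgodicLimit_of_intertwines (Set.range_nonempty _) hmul hle
      (fun i => coefficientMap_twistedKoopman γ π (EuclideanSpace.basisFun (Fin N) ℂ i))
      (sum_sliceMap_coefficientMap γ π) h
  · intro h
    rw [hT]
    have htop := eq_top_of_forall_coefficientMap_mem γ
      (isClosed_ergodicSubspace (Set.range_nonempty _) hmul hle)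
      fun N π hπ v f => by
        obtain ⟨y, hy⟩ := (hS N π).1 (h N π hπ) f
        exact ⟨_, hy.map (coefficientMap_twistedKoopman γ π v)⟩
    intro F
    exact htop.ge (Submodule.mem_top (x := F))
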